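/- Let $(\overline M,\overline g)$ be a Lorentzian manifold of dimension $n+2$ with Levi-Civita connection $\overline\nabla$, and let $M^{n+1}$ be a totally geodesic lightlike (immersed) hypersurface of $\overline M$: the induced metric $g=\langle\cdot,\cdot\rangle$ has rank-one radical $\mathrm{Rad}\,TM=TM\cap TM^\perp$, and the second fundamental form of $M$ vanishes. Assume that $\mathrm{Rad}\,TM$ is spanned by a global nowhere zero smooth vector field $\xi$, and fix a screen distribution, i.e. a smooth distribution $S(TM)$ with $TM=S(TM)\oplus\mathrm{Rad}\,TM$. Let $P:TM\to S(TM)$ be the corresponding projection, and let $N$ be the unique field of vectors of $T\overline M$ along $M$ with $\overline g(N,\xi)=1$, $\overline g(N,N)=0$ and $\overline g(N,W)=0$ for $W\in S(TM)$. Put $\eta=\overline g(N,\cdot)$ and $X^\flat=g(X,\cdot)+\eta(X)\eta$ on $TM$. Let $\nabla$ be the induced connection: $\nabla_XY$ is the $TM$-component of $\overline\nabla_XY$ in $T\overline M|_M=TM\oplus\mathrm{span}(N)$. For a function $f$, let $\nabla^g f$ be the vector field with $(\nabla^g f)^\flat=df$. Let $C(X,PY)=\eta\big(\nabla_X(PY)-P\,\nabla_X(PY)\big)$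 be the second fundamental form of the screen distribution. For an endomorphism field $S$ of $TM$, write $\nabla S(X,Y)=\nabla_X(SY)-S(\nabla_XY)$. Let $S$ be an $\mathcal A^\nabla$-tensor: a smooth endomorphism field of $TM$ that commutes with $P$ and satisfies $\langle SX,Y\rangle=\langle X,SY\rangle$ and $X^\flat(\nabla S(X,X))=0$ for all vector fields $X,Y$ on $M$. Assume that the number of distinct eigenvalues of $S$ is constant, that at each point they are the values of smooth functions $\lambda_0,\lambda_1,\dots,\lambda_k$ (pairwise distinct at every point), and that, with $D_\alpha=\ker(S-\lambda_\alpha I)$, one has $D_0=\mathrm{Rad}\,TM$. Let $\Gamma(D_\alpha)$ denote the smooth sections of $D_\alpha$. Then for each $1\le i\le k$ the following are equivalent: (a) $\nabla_XX$ takes values in $D_i$ for all $X\in\Gamma(D_i)$. (b) $\nabla_XY+\nabla_YX$ takes values in $D_i$ for all $X,Y\in\Gamma(D_i)$. (c) $\nabla S(X,X)=0$ for all $X\in\Gamma(D_i)$. (d) $\nabla S(X,Y)+\nabla S(Y,X)=0$ for all $X,Y\in\Gamma(D_i)$. (e) $\nabla^g\lambda_i$ is $D_0$-valued, and $C(X,X)=0$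 for all $X\in\Gamma(D_i)$. -/

import Mathlib

open Module Bundle
open scoped Manifold ContDiff

noncomputable section

namespace NullGeometry

/-- A smooth (everywhere defined) vector field on a `d`-dimensional manifold. -/
def SmoothField {d : ℕ} {M : Type*} [TopologicalSpace M]
    [ChartedSpace (EuclideanSpace ℝ (Fin d)) M] [IsManifold (𝓡 d) ∞ M]
    (X : ∀ p : M, TangentSpace (𝓡 d) p) : Prop :=
  ContMDiff (𝓡 d) (𝓡 d).tangent ∞ (fun p => (⟨p, X p⟩ : TangentBundle (𝓡 d) M))

/-- `X ∈ Γ(D)`: a smooth vector field with values in the family of subspaces `D`. -/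
def SmoothSectionOf {d : ℕ} {M : Type*} [TopologicalSpace M]
    [ChartedSpace (EuclideanSpace ℝ (Fin d)) M] [IsManifold (𝓡 d) ∞ M]
    (D : ∀ p : M, Submodule ℝ (TangentSpace (𝓡 d) p))
    (X : ∀ p : M, TangentSpace (𝓡 d) p) : Prop :=
  SmoothField X ∧ ∀ p, X p ∈ D p

/-- The eigenspace distribution `Ker (S - μ I)` of an endomorphism field. -/
def eigenDist {d : ℕ} {M : Type*} [TopologicalSpace M]
    [ChartedSpace (EuclideanSpace ℝ (Fin d)) M]
    (S : ∀ p : M, TangentSpace (𝓡 d) p →L[ℝ] TangentSpace (𝓡 d) p)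
    (μ : M → ℝ) (p : M) : Submodule ℝ (TangentSpace (𝓡 d) p) :=
  End.eigenspace (S p).toLinearMap (μ p)

/-! ### The ambient Lorentzian manifold -/

/-- A smooth Lorentzian metric, of signature `(-, +, ..., +)`: at each point there is a
timelike vector on whose orthogonal complement the metric is positive definite. -/
structure LorentzMetric (d : ℕ) (N : Type*) [TopologicalSpace N]
    [ChartedSpace (EuclideanSpace ℝ (Fin d)) N] [IsManifold (𝓡 d) ∞ N] where
  /-- the scalar product on each tangent space -/
  val : ∀ x : N, TangentSpace (𝓡 d) x →L[ℝ] TangentSpace (𝓡 d) x →L[ℝ] ℝ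
  symm : ∀ (x : N) (v w : TangentSpace (𝓡 d) x), val x v w = val x w v
  lorentz : ∀ x : N, ∃ v : TangentSpace (𝓡 d) x, val x v v < 0 ∧
    ∀ w : TangentSpace (𝓡 d) x, val x v w = 0 → w ≠ 0 → 0 < val x w w
  smooth : ContMDiff (𝓡 d)
    ((𝓡 d).prod 𝓘(ℝ, EuclideanSpace ℝ (Fin d) →L[ℝ] EuclideanSpace ℝ (Fin d) →L[ℝ] ℝ)) ∞
    (fun x => TotalSpace.mk' (EuclideanSpace ℝ (Fin d) →L[ℝ] EuclideanSpace ℝ (Fin d) →L[ℝ] ℝ)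
      x (val x))

section Ambient

variable {d : ℕ} {N : Type*} [TopologicalSpace N]
  [ChartedSpace (EuclideanSpace ℝ (Fin d)) N] [IsManifold (𝓡 d) ∞ N]

/-- `conn` is the Levi-Civita connection of `G`: torsion-free and metric. In Mathlib's convention
`conn Y x v` is `∇_v Y` at `x`. -/
structure IsLeviCivita (G : LorentzMetric d N)
    (conn : CovariantDerivative (𝓡 d) (EuclideanSpace ℝ (Fin d))
      (TangentSpace (𝓡 d) : N → Type _)) : Prop where
  torsion_free : conn.torsion = 0
  metric : ∀ (x : N) (Y Z : ∀ y : N, TangentSpace (𝓡 d) y),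
    MDifferentiableAt (𝓡 d) (𝓡 d).tangent
      (fun y => (⟨y, Y y⟩ : TangentBundle (𝓡 d) N)) x →
    MDifferentiableAt (𝓡 d) (𝓡 d).tangent
      (fun y => (⟨y, Z y⟩ : TangentBundle (𝓡 d) N)) x →
    ∀ v : TangentSpace (𝓡 d) x,
      mvfderiv (𝓡 d) (fun y => G.val y (Y y) (Z y)) x v
        = G.val x (conn Y x v) (Z x) + G.val x (Y x) (conn Z x v)

theorem LorentzMetric.nondegenerate (G : LorentzMetric d N) (x : N)
    (u : TangentSpace (𝓡 d) x) (h : ∀ w, G.val x u w = 0) : u = 0 := by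
  obtain ⟨v, -, hpos⟩ := G.lorentz x
  by_contra hu
  have h1 := hpos u (by rw [G.symm]; exact h v) hu
  rw [h u] at h1
  exact lt_irrefl _ h1

/-- A linear connection `conn` on `TN` acts on vector fields `V` along a map `f : M → N`. In the
local frame `(e_j)` of `TN` given by the preferred trivialization at `f p`, write
`V = ∑ j, V^j (e_j ∘ f)` near `p`; then
`(∇_v V)(p) = ∑ j, (dV^j(v) e_j + V^j(p) ∇_{df v} e_j)` at `f p`, for `v ∈ T_p M`. -/
def covAlong {m : ℕ} {M : Type*} [TopologicalSpace M]
    [ChartedSpace (EuclideanSpace ℝ (Fin m)) M]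
    (conn : CovariantDerivative (𝓡 d) (EuclideanSpace ℝ (Fin d))
      (TangentSpace (𝓡 d) : N → Type _))
    (f : M → N) (V : ∀ q : M, TangentSpace (𝓡 d) (f q))
    (p : M) (v : TangentSpace (𝓡 m) p) : TangentSpace (𝓡 d) (f p) :=
  let t := trivializationAt (EuclideanSpace ℝ (Fin d)) (TangentSpace (𝓡 d) : N → Type _) (f p)
  let b := (EuclideanSpace.basisFun (Fin d) ℝ).toBasis
  ∑ j, (mvfderiv (𝓡 m) (fun q => t.localFrameCoeff (𝓡 d) b j (f q) (V q)) p v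
          • t.localFrame b j (f p)
        + t.localFrameCoeff (𝓡 d) b j (f p) (V p)
          • conn (t.localFrame b j) (f p) (mfderiv (𝓡 m) (𝓡 d) f p v))

end Ambient

/-! ### Lightlike hypersurfaces with a screen distribution -/

/-- The (degenerate) metric induced by `G` through `f`. -/
def inducedForm {d m : ℕ} {N : Type*} [TopologicalSpace N]
    [ChartedSpace (EuclideanSpace ℝ (Fin d)) N] [IsManifold (𝓡 d) ∞ N]
    {M : Type*} [TopologicalSpace M] [ChartedSpace (EuclideanSpace ℝ (Fin m)) M]
    (G : LorentzMetric d N) (f : M → N) (p : M) (v w : TangentSpace (𝓡 m) p) : ℝ :=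
  G.val (f p) (mfderiv (𝓡 m) (𝓡 d) f p v) (mfderiv (𝓡 m) (𝓡 d) f p w)

/-- The radical `T_pM ∩ T_pM^⊥` of the induced metric. -/
def radical {d m : ℕ} {N : Type*} [TopologicalSpace N]
    [ChartedSpace (EuclideanSpace ℝ (Fin d)) N] [IsManifold (𝓡 d) ∞ N]
    {M : Type*} [TopologicalSpace M] [ChartedSpace (EuclideanSpace ℝ (Fin m)) M]
    (G : LorentzMetric d N) (f : M → N) (p : M) : Submodule ℝ (TangentSpace (𝓡 m) p) where
  carrier := {v | ∀ w, inducedForm G f p v w = 0}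
  add_mem' := by
    intro a b ha hb w
    have h1 := ha w
    have h2 := hb w
    simp only [inducedForm] at h1 h2 ⊢
    simp [h1, h2]
  zero_mem' := by
    intro w
    simp [inducedForm]
  smul_mem' := by
    intro c a ha w
    have h1 := ha w
    simp only [inducedForm] at h1 ⊢
    simp [h1]

/-- An immersed lightlike hypersurface `M^{n+1}` of the Lorentzian manifold `(N^{n+2}, G)`, with a
screen distribution `S(TM)` and a global nowhere zero section `ξ` of the radical distribution. -/
structure LightlikeHypersurface {n : ℕ} {N : Type*} [TopologicalSpace N]
    [ChartedSpace (EuclideanSpace ℝ (Fin (n + 2))) N] [IsManifold (𝓡 (n + 2)) ∞ N]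
    (G : LorentzMetric (n + 2) N)
    (M : Type*) [TopologicalSpace M]
    [ChartedSpace (EuclideanSpace ℝ (Fin (n + 1))) M] [IsManifold (𝓡 (n + 1)) ∞ M] where
  /-- the immersion -/
  emb : M → N
  emb_smooth : ContMDiff (𝓡 (n + 1)) (𝓡 (n + 2)) ∞ emb
  emb_immersion : ∀ p : M, Function.Injective (mfderiv (𝓡 (n + 1)) (𝓡 (n + 2)) emb p)
  /-- lightlike: the radical of the induced metric has rank one -/
  lightlike : ∀ p : M, finrank ℝ (radical (m := n + 1) G emb p) = 1
  /-- the screen distribution, a smooth distribution complementary to the radical -/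
  screen : ∀ p : M, Submodule ℝ (TangentSpace (𝓡 (n + 1)) p)
  screen_compl : ∀ p : M, IsCompl (screen p) (radical G emb p)
  screen_smooth : ∀ p : M, ∀ v ∈ screen p, ∃ X, SmoothSectionOf screen X ∧ X p = v
  /-- the global null vector field -/
  xi : ∀ p : M, TangentSpace (𝓡 (n + 1)) p
  xi_smooth : SmoothSectionOf (radical (m := n + 1) G emb) xi
  xi_ne_zero : ∀ p : M, xi p ≠ 0

namespace LightlikeHypersurface

variable {n : ℕ} {N : Type*} [TopologicalSpace N]
  [ChartedSpace (EuclideanSpace ℝ (Fin (n + 2))) N] [IsManifold (𝓡 (n + 2)) ∞ N]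
  {G : LorentzMetric (n + 2) N}
  {M : Type*} [TopologicalSpace M]
  [ChartedSpace (EuclideanSpace ℝ (Fin (n + 1))) M] [IsManifold (𝓡 (n + 1)) ∞ M]
  (L : LightlikeHypersurface G M)

/-- The differential of the immersion. -/
def dEmb (p : M) : TangentSpace (𝓡 (n + 1)) p →L[ℝ] TangentSpace (𝓡 (n + 2)) (L.emb p) :=
  mfderiv (𝓡 (n + 1)) (𝓡 (n + 2)) L.emb p

/-- The induced metric `g`, of signature `(0, +, ..., +)`. -/
def g (p : M) (v w : TangentSpace (𝓡 (n + 1)) p) : ℝ :=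
  inducedForm G L.emb p v w

/-- The radical distribution `Rad TM = TM^⊥`. -/
def rad (p : M) : Submodule ℝ (TangentSpace (𝓡 (n + 1)) p) :=
  radical G L.emb p

/-- The projection `P` of `TM` onto the screen distribution along the radical distribution. -/
def P (p : M) : TangentSpace (𝓡 (n + 1)) p →ₗ[ℝ] TangentSpace (𝓡 (n + 1)) p :=
  (L.screen p).projection (radical G L.emb p) (L.screen_compl p)

/-- The normalization equations `⟨N, ξ⟩ = 1`, `⟨N, N⟩ = 0`, `⟨N, W⟩ = 0` for `W` in the screen. -/
def IsTransversal (p : M) (V : TangentSpace (𝓡 (n + 2)) (L.emb p)) : Prop :=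
  G.val (L.emb p) V (L.dEmb p (L.xi p)) = 1 ∧ G.val (L.emb p) V V = 0 ∧
    ∀ W ∈ L.screen p, G.val (L.emb p) V (L.dEmb p W) = 0

theorem dEmb_xi (p : M) (v : TangentSpace (𝓡 (n + 1)) p) :
    G.val (L.emb p) (L.dEmb p v) (L.dEmb p (L.xi p)) = 0 := by
  rw [G.symm]
  exact L.xi_smooth.2 p v

theorem mem_rad (p : M) {v : TangentSpace (𝓡 (n + 1)) p} (hv : v ∈ radical G L.emb p) :
    ∃ c : ℝ, c • L.xi p = v := by
  have h := (finrank_eq_one_iff_of_nonzero' (⟨L.xi p, L.xi_smooth.2 p⟩ : radical G L.emb p)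
    (fun h0 => L.xi_ne_zero p (congrArg Subtype.val h0))).1 (L.lightlike p) ⟨v, hv⟩
  obtain ⟨c, hc⟩ := h
  exact ⟨c, congrArg Subtype.val hc⟩

theorem exists_transversal (p : M) : ∃ V, L.IsTransversal p V := by
  have : FiniteDimensional ℝ (TangentSpace (𝓡 (n + 2)) (L.emb p)) :=
    inferInstanceAs (FiniteDimensional ℝ (EuclideanSpace ℝ (Fin (n + 2))))
  let B : LinearMap.BilinForm ℝ (TangentSpace (𝓡 (n + 2)) (L.emb p)) :=
    LinearMap.mk₂ ℝ (fun v w => G.val (L.emb p) v w)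
      (by intro a b c; simp) (by intro c a b; simp) (by intro a b c; simp) (by intro c a b; simp)
  have hinj : Function.Injective B := by
    rw [← LinearMap.ker_eq_bot, LinearMap.ker_eq_bot']
    intro u hu
    exact G.nondegenerate _ u (fun w => congrArg (fun l => l w) hu)
  have hsurj : Function.Surjective B :=
    (LinearMap.injective_iff_surjective_of_finrank_eq_finrank
      (Subspace.dual_finrank_eq).symm).1 hinj
  have hdisj : L.dEmb p (L.xi p) ∉ (L.screen p).map (L.dEmb p).toLinearMap := by
    rintro ⟨W, hW, hWxi⟩
    have h1 : W = L.xi p := L.emb_immersion p hWxi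
    exact L.xi_ne_zero p ((Submodule.disjoint_def.1 (L.screen_compl p).disjoint) _
      (h1 ▸ hW) (L.xi_smooth.2 p))
  obtain ⟨f, hf, hf0⟩ := Submodule.exists_le_ker_of_notMem hdisj
  obtain ⟨U, hU⟩ := hsurj ((f (L.dEmb p (L.xi p)))⁻¹ • f)
  have hUv : ∀ w, G.val (L.emb p) U w = (f (L.dEmb p (L.xi p)))⁻¹ * f w :=
    fun w => congrArg (fun l => l w) hU
  have h1 : G.val (L.emb p) U (L.dEmb p (L.xi p)) = 1 := by
    rw [hUv, inv_mul_cancel₀ hf]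
  have h2 := L.dEmb_xi p
  have h3 := G.symm (L.emb p) (L.dEmb p (L.xi p)) U
  refine ⟨U - (G.val (L.emb p) U U / 2) • L.dEmb p (L.xi p), ?_, ?_, ?_⟩
  · simp [h1, h2]
  · simp [h1, h2, h3]
    ring
  · intro W hW
    have h4 : f (L.dEmb p W) = 0 := hf0 ⟨W, hW, rfl⟩
    have h5 := G.symm (L.emb p) (L.dEmb p (L.xi p)) (L.dEmb p W)
    simp [h2, h5, hUv, h4]

theorem isCompl_of_isTransversal (p : M) {V : TangentSpace (𝓡 (n + 2)) (L.emb p)}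
    (hV : L.IsTransversal p V) :
    IsCompl (LinearMap.range (L.dEmb p).toLinearMap) (Submodule.span ℝ {V}) := by
  have : FiniteDimensional ℝ (TangentSpace (𝓡 (n + 2)) (L.emb p)) :=
    inferInstanceAs (FiniteDimensional ℝ (EuclideanSpace ℝ (Fin (n + 2))))
  have hV0 : V ≠ 0 := by
    rintro rfl
    simpa using hV.1
  have hd : Disjoint (LinearMap.range (L.dEmb p).toLinearMap) (Submodule.span ℝ {V}) := by
    rw [Submodule.disjoint_def]
    rintro x ⟨y, rfl⟩ hx
    obtain ⟨c, hc⟩ := Submodule.mem_span_singleton.1 hx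
    have h1 := L.dEmb_xi p y
    have h2 : c • V = L.dEmb p y := hc
    rw [← h2] at h1
    simp [hV.1] at h1
    rw [← hc, h1, zero_smul]
  refine ⟨hd, codisjoint_iff.2 (Submodule.eq_top_of_disjoint _ _ ?_ hd)⟩
  rw [LinearMap.finrank_range_of_inj (f := (L.dEmb p).toLinearMap) (L.emb_immersion p), finrank_span_singleton hV0]
  have h1 : finrank ℝ (TangentSpace (𝓡 (n + 1)) p) = n + 1 :=
    (finrank_euclideanSpace_fin : finrank ℝ (EuclideanSpace ℝ (Fin (n + 1))) = n + 1)
  have h2 : finrank ℝ (TangentSpace (𝓡 (n + 2)) (L.emb p)) = n + 2 :=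
    (finrank_euclideanSpace_fin : finrank ℝ (EuclideanSpace ℝ (Fin (n + 2))) = n + 2)
  omega

theorem isTransversal_unique (p : M) {V W : TangentSpace (𝓡 (n + 2)) (L.emb p)}
    (hV : L.IsTransversal p V) (hW : L.IsTransversal p W) : V = W := by
  have hperp : ∀ Y, G.val (L.emb p) (V - W) (L.dEmb p Y) = 0 := by
    intro Y
    obtain ⟨a, ha, b, hb, rfl⟩ := Submodule.mem_sup.1
      ((L.screen_compl p).sup_eq_top ▸ Submodule.mem_top (x := Y))
    obtain ⟨c, rfl⟩ := L.mem_rad p hb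
    simp [hV.1, hW.1, hV.2.2 a ha, hW.2.2 a ha]
  obtain ⟨a, ⟨Y, rfl⟩, b, hb, hab⟩ := Submodule.mem_sup.1
    ((L.isCompl_of_isTransversal p hV).sup_eq_top ▸ Submodule.mem_top (x := V - W))
  obtain ⟨c, rfl⟩ := Submodule.mem_span_singleton.1 hb
  have hab' : L.dEmb p Y + c • V = V - W := hab
  have hc : c = 0 := by
    have h := hperp (L.xi p)
    rw [← hab'] at h
    simpa [hV.1, L.dEmb_xi p Y] using h
  rw [hc, zero_smul, add_zero] at hab'
  obtain ⟨r, rfl⟩ := L.mem_rad p (v := Y) (fun w => by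
    have h := hperp w
    rw [← hab'] at h
    exact h)
  have hW' : W = V - r • L.dEmb p (L.xi p) := by
    rw [← map_smul, hab']
    abel
  have h := hW.2.1
  have h0 := hV.2.1
  have h1 := hV.1
  have h2 := L.dEmb_xi p (L.xi p)
  have h3 := G.symm (L.emb p) (L.dEmb p (L.xi p)) V
  rw [hW'] at h
  simp [h0, h1, h2, h3] at h
  have hr : r = 0 := by linarith
  rw [hW', hr, zero_smul, sub_zero]

/-- The null transversal vector field `N` of the normalizing pair `{ξ, N}`. -/
def transversal (p : M) : TangentSpace (𝓡 (n + 2)) (L.emb p) :=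
  (L.exists_transversal p).choose

theorem transversal_spec (p : M) : L.IsTransversal p (L.transversal p) :=
  (L.exists_transversal p).choose_spec

/-- The transversal line `tr(TM)_p`. -/
def tr (p : M) : Submodule ℝ (TangentSpace (𝓡 (n + 2)) (L.emb p)) :=
  Submodule.span ℝ {L.transversal p}

/-- The decomposition `TN|_M = TM ⊕ tr(TM)`. -/
theorem isCompl_tr (p : M) : IsCompl (LinearMap.range (L.dEmb p).toLinearMap) (L.tr p) :=
  L.isCompl_of_isTransversal p (L.transversal_spec p)

/-- The projection `Q` of `TN|_M` onto `TM` along `tr(TM)`. -/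
def Q (p : M) : TangentSpace (𝓡 (n + 2)) (L.emb p) →ₗ[ℝ] TangentSpace (𝓡 (n + 1)) p :=
  (LinearEquiv.ofInjective (L.dEmb p).toLinearMap (L.emb_immersion p)).symm.toLinearMap ∘ₗ
    Submodule.projectionOnto _ _ (L.isCompl_tr p)

variable (conn : CovariantDerivative (𝓡 (n + 2)) (EuclideanSpace ℝ (Fin (n + 2)))
  (TangentSpace (𝓡 (n + 2)) : N → Type _))

/-- The ambient derivative of `Y` in the direction of `X`, for vector fields `X, Y` on `M`. -/
def ambient (X Y : ∀ p : M, TangentSpace (𝓡 (n + 1)) p) (p : M) :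
    TangentSpace (𝓡 (n + 2)) (L.emb p) :=
  covAlong conn L.emb (fun q => L.dEmb q (Y q)) p (X p)

/-- The induced connection `∇_X Y`, the `TM`-component of the ambient derivative. -/
def nabla (X Y : ∀ p : M, TangentSpace (𝓡 (n + 1)) p) (p : M) : TangentSpace (𝓡 (n + 1)) p :=
  L.Q p (L.ambient conn X Y p)

/-- The second fundamental form `h(X, Y)`, the `tr(TM)`-component of the ambient derivative. -/
def secondForm (X Y : ∀ p : M, TangentSpace (𝓡 (n + 1)) p) (p : M) :
    TangentSpace (𝓡 (n + 2)) (L.emb p) :=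
  L.ambient conn X Y p - L.dEmb p (L.nabla conn X Y p)

/-- `M` is totally geodesic: its second fundamental form vanishes identically. -/
def TotallyGeodesic : Prop :=
  ∀ X Y : (∀ p : M, TangentSpace (𝓡 (n + 1)) p), SmoothField X → SmoothField Y →
    ∀ p, L.secondForm conn X Y p = 0

/-- The one-form `η = ⟨N, ·⟩` on `M`. -/
def eta (p : M) : TangentSpace (𝓡 (n + 1)) p →ₗ[ℝ] ℝ :=
  ((G.val (L.emb p) (L.transversal p)).comp (L.dEmb p)).toLinearMap

/-- The associated nondegenerate metric `g~(v, w) = v^♭(w) = g(v, w) + η(v) η(w)`. -/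
def flat (p : M) : LinearMap.BilinForm ℝ (TangentSpace (𝓡 (n + 1)) p) :=
  LinearMap.mk₂ ℝ (fun v w => L.g p v w + L.eta p v * L.eta p w)
    (by intro a b c; simp [g, inducedForm]; ring)
    (by intro c a b; simp [g, inducedForm]; ring)
    (by intro a b c; simp [g, inducedForm]; ring)
    (by intro c a b; simp [g, inducedForm]; ring)

theorem flat_nondegenerate (p : M) : (L.flat p).Nondegenerate := by
  have hs : ∀ v w, L.flat p v w = L.flat p w v := by
    intro v w
    simp [flat, g, inducedForm, G.symm (L.emb p) (mfderiv (𝓡 (n + 1)) (𝓡 (n + 2)) L.emb p v),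
      mul_comm]
  have key : ∀ v, (∀ w, L.flat p v w = 0) → v = 0 := by
    intro v hv
    have hxi : L.eta p (L.xi p) = 1 := (L.transversal_spec p).1
    have hg : ∀ w, L.g p v w + L.eta p v * L.eta p w = 0 := hv
    have hgxi : L.g p v (L.xi p) = 0 := L.dEmb_xi p v
    have h1 := hg (L.xi p)
    rw [hgxi, hxi] at h1
    have heta : L.eta p v = 0 := by linarith
    obtain ⟨c, rfl⟩ := L.mem_rad p (v := v) (fun w => by
      have h := hg w
      rw [heta, zero_mul, add_zero] at h
      exact h)
    rw [map_smul, hxi] at heta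
    have hc : c = 0 := by simpa using heta
    rw [hc, zero_smul]
  exact ⟨key, fun v hv => key v (fun w => (hs v w).trans (hv w))⟩

/-- The gradient of a function with respect to the degenerate metric: `g~(grad f, v) = df(v)`. -/
def grad (f : M → ℝ) (p : M) : TangentSpace (𝓡 (n + 1)) p :=
  haveI : FiniteDimensional ℝ (TangentSpace (𝓡 (n + 1)) p) :=
    inferInstanceAs (FiniteDimensional ℝ (EuclideanSpace ℝ (Fin (n + 1))))
  ((L.flat p).toDual (L.flat_nondegenerate p)).symm
    (mvfderiv (𝓡 (n + 1)) f p).toLinearMap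

/-- The second fundamental form of the screen, `h*(X, PY)`: the radical part of `∇_X (PY)`. -/
def screenForm (X Y : ∀ p : M, TangentSpace (𝓡 (n + 1)) p) (p : M) :
    TangentSpace (𝓡 (n + 1)) p :=
  L.nabla conn X (fun q => L.P q (Y q)) p
    - L.P p (L.nabla conn X (fun q => L.P q (Y q)) p)

/-- The local second fundamental form of the screen, `C(X, PY) = ⟨h*(X, PY), N⟩`. -/
def C (X Y : ∀ p : M, TangentSpace (𝓡 (n + 1)) p) (p : M) : ℝ :=
  L.eta p (L.screenForm conn X Y p)

/-- `∇S(X, Y) = (∇_X S) Y = ∇_X (SY) - S(∇_X Y)`. -/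
def nablaS (S : ∀ p : M, TangentSpace (𝓡 (n + 1)) p →L[ℝ] TangentSpace (𝓡 (n + 1)) p)
    (X Y : ∀ p : M, TangentSpace (𝓡 (n + 1)) p) (p : M) : TangentSpace (𝓡 (n + 1)) p :=
  L.nabla conn X (fun q => S q (Y q)) p - S p (L.nabla conn X Y p)

/-- `A^∇`-tensors: smooth, screen preserving, `g`-symmetric endomorphism fields `S` of `TM` with
`X^♭(∇S(X, X)) = 0`. -/
structure IsATensor
    (S : ∀ p : M, TangentSpace (𝓡 (n + 1)) p →L[ℝ] TangentSpace (𝓡 (n + 1)) p) : Prop where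
  smooth : ContMDiff (𝓡 (n + 1))
    ((𝓡 (n + 1)).prod 𝓘(ℝ, EuclideanSpace ℝ (Fin (n + 1)) →L[ℝ] EuclideanSpace ℝ (Fin (n + 1)))) ∞
    (fun p => TotalSpace.mk' (EuclideanSpace ℝ (Fin (n + 1)) →L[ℝ] EuclideanSpace ℝ (Fin (n + 1)))
      (E := fun p : M => TangentSpace (𝓡 (n + 1)) p →L[ℝ] TangentSpace (𝓡 (n + 1)) p) p (S p))
  screen_preserving : ∀ p v, L.P p (S p v) = S p (L.P p v)
  symmetric : ∀ p v w, L.g p (S p v) w = L.g p v (S p w)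
  cyclic : ∀ X : (∀ p : M, TangentSpace (𝓡 (n + 1)) p), SmoothField X →
    ∀ p, L.flat p (X p) (L.nablaS conn S X X p) = 0

/-- `lam 0, ..., lam k` are the eigenfunctions of `S`: smooth functions which at each point are
the distinct eigenvalues of `S`, numbered so that `Ker (S - lam 0 I)` is the radical distribution.
In particular the number of distinct eigenvalues is constant. -/
structure IsEigenSystem
    (S : ∀ p : M, TangentSpace (𝓡 (n + 1)) p →L[ℝ] TangentSpace (𝓡 (n + 1)) p)
    {k : ℕ} (lam : Fin (k + 1) → M → ℝ) : Prop where
  smooth : ∀ a, ContMDiff (𝓡 (n + 1)) 𝓘(ℝ, ℝ) ∞ (lam a)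
  distinct : ∀ p, Function.Injective (fun a => lam a p)
  eigenvalues : ∀ p (μ : ℝ), End.HasEigenvalue (S p).toLinearMap μ ↔ ∃ a, lam a p = μ
  radical_eq : ∀ p, eigenDist S (lam 0) p = L.rad p

end LightlikeHypersurface

end NullGeometry

end

open NullGeometry

namespace NullGeometry

/-! The form g~ = g + η ⊗ η is positive definite, and S is self-adjoint for it: S commutes with P
and preserves the radical line, so η ∘ S = λ_0 η. Hence TM is the g~-orthogonal sum of the D_a, and
a vector lies in D_i as soon as it is orthogonal to every other D_a (`mem_eigenDist_of_flat`).

For a section X of D_i, ∇S(X,X) = dλ_i(X) X - (S - λ_i)∇_X X. The last term is orthogonal to D_i, so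
pairing with X and using the cyclic condition gives dλ_i(X) = 0, whence (a) ⇔ (c). Polarization
gives (a) ⇔ (b) and (c) ⇔ (d).

For (e), polarize the cyclic condition with X in D_i, i ≠ 0, and Y in D_b, b ≠ i. Total geodesy
makes the induced connection compatible with g, so g(X, ∇_X Y) = -g(∇_X X, Y). This yields
`mvfderiv_eigenfunction`: dλ_i(Y) g~(X,X) = (λ_b - λ_i)(g~(Y, ∇_X X) + g(∇_X X, Y)). For b ≠ 0 the
D_b-component of ∇_X X is thus controlled by dλ_i on D_b. The D_0-component is η(∇_X X) = C(X,X).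
Passing from points to fields requires that every eigenvector extend to a smooth section of its
eigendistribution (`exists_section`). -/

theorem mvfderiv_fun_sum {E H M : Type*} [NormedAddCommGroup E] [NormedSpace ℝ E]
    [TopologicalSpace H] {I : ModelWithCorners ℝ E H} [TopologicalSpace M] [ChartedSpace H M]
    {ι : Type*} {s : Finset ι} {f : ι → M → ℝ} {x : M}
    (hf : ∀ i ∈ s, MDifferentiableAt I 𝓘(ℝ, ℝ) (f i) x) :
    MDifferentiableAt I 𝓘(ℝ, ℝ) (fun y => ∑ i ∈ s, f i y) x ∧
      mvfderiv I (fun y => ∑ i ∈ s, f i y) x = ∑ i ∈ s, mvfderiv I (f i) x := by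
  classical
  induction s using Finset.induction_on with
  | empty => simpa using ⟨mdifferentiableAt_const, mvfderiv_const (I := I) (0 : ℝ) (x := x)⟩
  | insert a s ha ih =>
    obtain ⟨h1, h2⟩ := ih fun i hi => hf i (Finset.mem_insert_of_mem hi)
    have h3 := hf a (Finset.mem_insert_self a s)
    simp only [Finset.sum_insert ha]
    exact ⟨h3.add h1, by rw [mvfderiv_fun_add h3 h1, h2]⟩

theorem mvfderiv_congr {E H M : Type*} [NormedAddCommGroup E] [NormedSpace ℝ E]
    [TopologicalSpace H] {I : ModelWithCorners ℝ E H} [TopologicalSpace M] [ChartedSpace H M]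
    {f g : M → ℝ} {x : M} (h : f =ᶠ[nhds x] g) : mvfderiv I f x = mvfderiv I g x :=
  h.mfderiv_eq (I := I) (I' := 𝓘(ℝ, ℝ))

/-! ### Covariant differentiation of vector fields along a map. -/

section Along

variable {d m : ℕ} {N : Type*} [TopologicalSpace N]
  [ChartedSpace (EuclideanSpace ℝ (Fin d)) N] [IsManifold (𝓡 d) ∞ N]
  {M : Type*} [TopologicalSpace M] [ChartedSpace (EuclideanSpace ℝ (Fin m)) M]
  {f : M → N} {V W : ∀ q : M, TangentSpace (𝓡 d) (f q)} {p : M}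

/-- Differentiability at a point of a vector field along a map. -/
def DifferentiableAlongAt (m : ℕ) {M : Type*} [TopologicalSpace M]
    [ChartedSpace (EuclideanSpace ℝ (Fin m)) M] (f : M → N) (V : ∀ q : M, TangentSpace (𝓡 d) (f q)) (p : M) : Prop :=
  MDifferentiableAt (𝓡 m) (𝓡 d).tangent (fun q => (⟨f q, V q⟩ : TangentBundle (𝓡 d) N)) p

theorem DifferentiableAlongAt.mdifferentiableAt_base (hV : DifferentiableAlongAt m f V p) :
    MDifferentiableAt (𝓡 m) (𝓡 d) f p :=
  ((mdifferentiableAt_totalSpace (𝓡 d) _).1 hV).1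

/-- Near `p`, the image of `f` lies in the base set of the trivialization at `f p`. -/
theorem eventually_mem_baseSet (hf : MDifferentiableAt (𝓡 m) (𝓡 d) f p) :
    ∀ᶠ q in nhds p, f q ∈ (trivializationAt (EuclideanSpace ℝ (Fin d))
      (TangentSpace (𝓡 d) : N → Type _) (f p)).baseSet :=
  hf.continuousAt.eventually_mem ((trivializationAt (EuclideanSpace ℝ (Fin d))
      (TangentSpace (𝓡 d) : N → Type _) (f p)).open_baseSet.mem_nhds
        (mem_baseSet_trivializationAt _ _ _))

theorem DifferentiableAlongAt.coeff (hV : DifferentiableAlongAt m f V p) (j : Fin d) :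
    MDifferentiableAt (𝓡 m) 𝓘(ℝ, ℝ) (fun q => (trivializationAt (EuclideanSpace ℝ (Fin d))
      (TangentSpace (𝓡 d) : N → Type _) (f p)).localFrameCoeff (𝓡 d)
        (EuclideanSpace.basisFun (Fin d) ℝ).toBasis j (f q) (V q)) p := by
  set t := trivializationAt (EuclideanSpace ℝ (Fin d)) (TangentSpace (𝓡 d) : N → Type _) (f p)
  obtain ⟨h1, h2⟩ := (mdifferentiableAt_totalSpace (𝓡 d) _).1 hV
  have h3 : MDifferentiableAt 𝓘(ℝ, EuclideanSpace ℝ (Fin d)) 𝓘(ℝ, ℝ)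
      (EuclideanSpace.proj j : EuclideanSpace ℝ (Fin d) →L[ℝ] ℝ) (t ⟨f p, V p⟩).2 :=
    (ContinuousLinearMap.differentiableAt _).mdifferentiableAt
  classical
  refine (h3.comp p h2).congr_of_eventuallyEq ?_
  filter_upwards [eventually_mem_baseSet h1] with q hq
  -- The coefficient formula is about sections over the target, whereas `V` is only a field along
  -- `f`. The single vector `V q` is therefore extended by zero.
  have h4 := t.localFrameCoeff_apply_of_mem_baseSet (I := 𝓡 d)
    (EuclideanSpace.basisFun (Fin d) ℝ).toBasis hq
    (Function.update (fun y => (0 : TangentSpace (𝓡 d) y)) (f q) (V q)) j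
  rw [Function.update_self] at h4
  rw [h4]
  simp [Trivialization.basisAt, t, Function.comp]

theorem localFrame_expansion {x y : N}
    (hy : y ∈ (trivializationAt (EuclideanSpace ℝ (Fin d))
      (TangentSpace (𝓡 d) : N → Type _) x).baseSet) (v : TangentSpace (𝓡 d) y) :
    v = ∑ j, (trivializationAt (EuclideanSpace ℝ (Fin d))
      (TangentSpace (𝓡 d) : N → Type _) x).localFrameCoeff (𝓡 d)
        (EuclideanSpace.basisFun (Fin d) ℝ).toBasis j y v •
      (trivializationAt (EuclideanSpace ℝ (Fin d))
      (TangentSpace (𝓡 d) : N → Type _) x).localFrame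
        (EuclideanSpace.basisFun (Fin d) ℝ).toBasis j y := by
  classical
  have h := Trivialization.eq_sum_localFrameCoeff_smul (I := 𝓡 d)
    (b := (EuclideanSpace.basisFun (Fin d) ℝ).toBasis)
    (s := Function.update (fun y => (0 : TangentSpace (𝓡 d) y)) y v) hy
  rwa [Function.update_self] at h

variable (conn : CovariantDerivative (𝓡 d) (EuclideanSpace ℝ (Fin d))
      (TangentSpace (𝓡 d) : N → Type _))

theorem covAlong_add (hV : DifferentiableAlongAt m f V p) (hW : DifferentiableAlongAt m f W p)
    (v : TangentSpace (𝓡 m) p) :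
    covAlong conn f (fun q => V q + W q) p v = covAlong conn f V p v + covAlong conn f W p v := by
  simp only [covAlong, ← Finset.sum_add_distrib]
  refine Finset.sum_congr rfl fun j _ => ?_
  simp only [map_add]
  rw [mvfderiv_fun_add (hV.coeff j) (hW.coeff j), add_apply]
  module

theorem covAlong_add_left (v w : TangentSpace (𝓡 m) p) :
    covAlong conn f V p (v + w) = covAlong conn f V p v + covAlong conn f V p w := by
  simp only [covAlong, ← Finset.sum_add_distrib]
  refine Finset.sum_congr rfl fun j _ => ?_
  simp only [map_add]
  module

theorem covAlong_smul {h : M → ℝ} (hh : MDifferentiableAt (𝓡 m) 𝓘(ℝ, ℝ) h p)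
    (hV : DifferentiableAlongAt m f V p) (v : TangentSpace (𝓡 m) p) :
    covAlong conn f (fun q => h q • V q) p v =
      mvfderiv (𝓡 m) h p v • V p + h p • covAlong conn f V p v := by
  -- With `V p` expanded in the frame, the Leibniz rule can be checked one coefficient at a time.
  conv_rhs => rw [localFrame_expansion (mem_baseSet_trivializationAt _ _ _) (V p)]
  simp only [covAlong, Finset.smul_sum, ← Finset.sum_add_distrib]
  refine Finset.sum_congr rfl fun j _ => ?_
  simp only [map_smul, smul_eq_mul]
  rw [mvfderiv_fun_mul hh (hV.coeff j), add_apply]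
  simp only [smul_apply, smul_eq_mul]
  module

theorem LorentzMetric.mdifferentiableAt_apply (G : LorentzMetric d N) {x : N}
    {Y Z : ∀ y : N, TangentSpace (𝓡 d) y}
    (hY : MDifferentiableAt (𝓡 d) (𝓡 d).tangent
      (fun y => (⟨y, Y y⟩ : TangentBundle (𝓡 d) N)) x)
    (hZ : MDifferentiableAt (𝓡 d) (𝓡 d).tangent
      (fun y => (⟨y, Z y⟩ : TangentBundle (𝓡 d) N)) x) :
    MDifferentiableAt (𝓡 d) 𝓘(ℝ, ℝ) (fun y => G.val y (Y y) (Z y)) x := by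
  have h : MDifferentiableAt (𝓡 d) ((𝓡 d).prod 𝓘(ℝ))
      (fun y => TotalSpace.mk' ℝ (E := Bundle.Trivial N ℝ) y (G.val y (Y y) (Z y))) x := by
    apply MDifferentiableAt.clm_bundle_apply₂ (F₁ := EuclideanSpace ℝ (Fin d))
      (F₂ := EuclideanSpace ℝ (Fin d))
    · exact G.smooth.mdifferentiableAt (by simp)
    · exact hY
    · exact hZ
  rw [mdifferentiableAt_totalSpace] at h
  exact h.2

/-- Metric compatibility of the covariant derivative along a map. -/
theorem mvfderiv_metric_along {G : LorentzMetric d N} (hconn : IsLeviCivita G conn)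
    (hV : DifferentiableAlongAt m f V p) (hW : DifferentiableAlongAt m f W p)
    (v : TangentSpace (𝓡 m) p) :
    mvfderiv (𝓡 m) (fun q => G.val (f q) (V q) (W q)) p v =
      G.val (f p) (covAlong conn f V p v) (W p) + G.val (f p) (V p) (covAlong conn f W p v) := by
  let t := trivializationAt (EuclideanSpace ℝ (Fin d)) (TangentSpace (𝓡 d) : N → Type _) (f p)
  let e : Fin d → ∀ y : N, TangentSpace (𝓡 d) y :=
    t.localFrame (EuclideanSpace.basisFun (Fin d) ℝ).toBasis
  let κ : Fin d → ∀ y : N, TangentSpace (𝓡 d) y →ₗ[ℝ] ℝ :=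
    t.localFrameCoeff (𝓡 d) (EuclideanSpace.basisFun (Fin d) ℝ).toBasis
  have hf := hV.mdifferentiableAt_base
  have hmem : f p ∈ t.baseSet := mem_baseSet_trivializationAt _ _ _
  have he : ∀ j, MDifferentiableAt (𝓡 d) (𝓡 d).tangent
      (fun y => (⟨y, e j y⟩ : TangentBundle (𝓡 d) N)) (f p) := fun j =>
    (contMDiffAt_localFrame_of_mem (I := 𝓡 d) 1 t _ j hmem).mdifferentiableAt (by simp)
  have hexp : ∀ y ∈ t.baseSet, ∀ u : TangentSpace (𝓡 d) y, u = ∑ j, κ j y u • e j y :=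
    fun y hy u => localFrame_expansion hy u
  have hcov : ∀ U : (∀ q : M, TangentSpace (𝓡 d) (f q)), covAlong conn f U p v =
      ∑ j, (mvfderiv (𝓡 m) (fun q => κ j (f q) (U q)) p v • e j (f p) +
        κ j (f p) (U p) • conn (e j) (f p) (mfderiv (𝓡 m) (𝓡 d) f p v)) := fun U => rfl
  have ha : ∀ j, MDifferentiableAt (𝓡 m) 𝓘(ℝ, ℝ) (fun q => κ j (f q) (V q)) p :=
    fun j => hV.coeff j
  have hc : ∀ j, MDifferentiableAt (𝓡 m) 𝓘(ℝ, ℝ) (fun q => κ j (f q) (W q)) p :=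
    fun j => hW.coeff j
  -- From here on the frame is abstract: only its differentiability, the expansion `hexp` and the
  -- formula `hcov` matter.
  clear_value t e κ
  have hG : ∀ i j, MDifferentiableAt (𝓡 d) 𝓘(ℝ, ℝ)
      (fun y => G.val y (e i y) (e j y)) (f p) := fun i j =>
    G.mdifferentiableAt_apply (he i) (he j)
  have hGf : ∀ i j, MDifferentiableAt (𝓡 m) 𝓘(ℝ, ℝ)
      (fun q => G.val (f q) (e i (f q)) (e j (f q))) p := fun i j =>
    (hG i j).comp p hf
  -- Metric compatibility on the target, applied to frame fields and pulled back by the chain rule.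
  have hGd : ∀ i j, mvfderiv (𝓡 m) (fun q => G.val (f q) (e i (f q)) (e j (f q))) p v =
      G.val (f p) (conn (e i) (f p) (mfderiv (𝓡 m) (𝓡 d) f p v)) (e j (f p)) +
        G.val (f p) (e i (f p)) (conn (e j) (f p) (mfderiv (𝓡 m) (𝓡 d) f p v)) := fun i j =>
    (mvfderiv_comp_apply p (hG i j) hf v).trans (hconn.metric (f p) (e i) (e j) (he i) (he j) _)
  have hloc : (fun q => G.val (f q) (V q) (W q)) =ᶠ[nhds p] fun q => ∑ i, ∑ j,
      (κ i (f q) (V q) * κ j (f q) (W q)) * G.val (f q) (e i (f q)) (e j (f q)) := by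
    filter_upwards [hf.continuousAt.eventually_mem (t.open_baseSet.mem_nhds hmem)] with q hq
    conv_lhs => rw [hexp _ hq (V q), hexp _ hq (W q)]
    simp only [map_sum, map_smul, FunLike.coe_sum, Finset.sum_apply,
      FunLike.coe_smul, Pi.smul_apply, smul_eq_mul, Finset.mul_sum]
    rw [Finset.sum_comm]
    refine Finset.sum_congr rfl fun i _ => Finset.sum_congr rfl fun j _ => ?_
    ring
  have hterm : ∀ i j, MDifferentiableAt (𝓡 m) 𝓘(ℝ, ℝ) (fun q =>
      (κ i (f q) (V q) * κ j (f q) (W q)) * G.val (f q) (e i (f q)) (e j (f q))) p :=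
    fun i j => ((ha i).mul (hc j)).mul (hGf i j)
  have htermd : ∀ i j, mvfderiv (𝓡 m) (fun q =>
      (κ i (f q) (V q) * κ j (f q) (W q)) * G.val (f q) (e i (f q)) (e j (f q))) p v =
      (κ i (f p) (V p) * κ j (f p) (W p)) *
        (G.val (f p) (conn (e i) (f p) (mfderiv (𝓡 m) (𝓡 d) f p v)) (e j (f p)) +
        G.val (f p) (e i (f p)) (conn (e j) (f p) (mfderiv (𝓡 m) (𝓡 d) f p v))) +
      G.val (f p) (e i (f p)) (e j (f p)) *
        (κ i (f p) (V p) * mvfderiv (𝓡 m) (fun q => κ j (f q) (W q)) p v +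
          κ j (f p) (W p) * mvfderiv (𝓡 m) (fun q => κ i (f q) (V q)) p v) := fun i j => by
    have hac : MDifferentiableAt (𝓡 m) 𝓘(ℝ, ℝ)
        (fun q => κ i (f q) (V q) * κ j (f q) (W q)) p := (ha i).mul (hc j)
    rw [mvfderiv_fun_mul hac (hGf i j), mvfderiv_fun_mul (ha i) (hc j), ← hGd]
    simp only [add_apply, smul_apply, smul_eq_mul]
  have hrow := fun i => mvfderiv_fun_sum (s := Finset.univ) fun j _ => hterm i j
  rw [mvfderiv_congr hloc, (mvfderiv_fun_sum fun i _ => (hrow i).1).2]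
  simp only [(hrow _).2, FunLike.coe_sum, Finset.sum_apply, htermd]
  have hVp := hexp _ hmem (V p)
  have hWp := hexp _ hmem (W p)
  rw [hcov V, hcov W]
  generalize V p = v₀ at hVp ⊢
  generalize W p = w₀ at hWp ⊢
  -- The coefficients get names so that substituting the expansions of `v₀` and `w₀` does not
  -- rewrite inside the coefficients themselves.
  obtain ⟨α, hα⟩ : ∃ α : Fin d → ℝ, ∀ j, κ j (f p) v₀ = α j := ⟨_, fun _ => rfl⟩
  obtain ⟨β, hβ⟩ : ∃ β : Fin d → ℝ, ∀ j, κ j (f p) w₀ = β j := ⟨_, fun _ => rfl⟩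
  simp only [hα, hβ] at hVp hWp ⊢
  rw [hVp, hWp]
  simp only [map_sum, map_smul, map_add, FunLike.coe_sum, Finset.sum_apply,
    FunLike.coe_smul, FunLike.coe_add, Pi.add_apply, Pi.smul_apply, smul_eq_mul, Finset.mul_sum]
  rw [Finset.sum_comm, ← Finset.sum_add_distrib]
  refine Finset.sum_congr rfl fun j _ => ?_
  simp only [← Finset.sum_add_distrib]
  refine Finset.sum_congr rfl fun i _ => ?_
  ring

end Along

/-- A self-adjoint endomorphism of a finite-dimensional Euclidean vector space is diagonalizable. -/
theorem iSup_eigenspace_eq_top {V : Type*} [AddCommGroup V] [Module ℝ V] [FiniteDimensional ℝ V]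
    (B : LinearMap.BilinForm ℝ V) (hsymm : ∀ v w, B v w = B w v) (hpos : ∀ v, v ≠ 0 → 0 < B v v)
    (T : End ℝ V) (hT : ∀ v w, B (T v) w = B v (T w)) : ⨆ μ, End.eigenspace T μ = ⊤ := by
  have hnonneg : ∀ v, 0 ≤ B v v := fun v => by
    rcases eq_or_ne v 0 with rfl | hv
    · simp
    · exact (hpos v hv).le
  -- `B` is made the inner product, so that the spectral theorem for symmetric operators applies.
  let c : InnerProductSpace.Core ℝ V :=
    { inner := fun v w => B v w
      conj_inner_symm := fun v w => hsymm w v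
      re_inner_nonneg := hnonneg
      add_left := fun u v w => by simp
      smul_left := fun v w r => by simp
      definite := fun v hv => by
        by_contra h
        exact (hpos v h).ne' hv }
  let : NormedAddCommGroup V := c.toNormedAddCommGroup
  let : InnerProductSpace ℝ V := InnerProductSpace.ofCore c.toCore
  have hsym : LinearMap.IsSymmetric T := hT
  have h := hsym.orthogonalComplement_iSup_eigenspaces_eq_bot
  rwa [Submodule.orthogonal_eq_bot_iff] at h

/-! ### Smooth vector fields: algebra and extension of tangent vectors. -/

section Fields

variable {d : ℕ} {M : Type*} [TopologicalSpace M]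
  [ChartedSpace (EuclideanSpace ℝ (Fin d)) M] [IsManifold (𝓡 d) ∞ M]
  {X Y : ∀ p : M, TangentSpace (𝓡 d) p}

theorem SmoothField.add (hX : SmoothField X) (hY : SmoothField Y) :
    SmoothField fun p => X p + Y p :=
  ContMDiff.add_section hX hY

theorem SmoothField.sub (hX : SmoothField X) (hY : SmoothField Y) :
    SmoothField fun p => X p - Y p :=
  ContMDiff.sub_section hX hY

theorem SmoothField.smul {h : M → ℝ} (hh : ContMDiff (𝓡 d) 𝓘(ℝ, ℝ) ∞ h) (hX : SmoothField X) :
    SmoothField fun p => h p • X p :=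
  ContMDiff.smul_section hh hX

theorem SmoothField.endomorphism_apply
    {S : ∀ p : M, TangentSpace (𝓡 d) p →L[ℝ] TangentSpace (𝓡 d) p}
    (hS : ContMDiff (𝓡 d)
      ((𝓡 d).prod 𝓘(ℝ, EuclideanSpace ℝ (Fin d) →L[ℝ] EuclideanSpace ℝ (Fin d))) ∞
      (fun p => TotalSpace.mk' (EuclideanSpace ℝ (Fin d) →L[ℝ] EuclideanSpace ℝ (Fin d))
        (E := fun p : M => TangentSpace (𝓡 d) p →L[ℝ] TangentSpace (𝓡 d) p) p (S p)))
    (hX : SmoothField X) : SmoothField fun p => S p (X p) :=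
  ContMDiff.clm_bundle_apply (F₁ := EuclideanSpace ℝ (Fin d)) (F₂ := EuclideanSpace ℝ (Fin d))
    hS hX

/-- Every tangent vector extends to a global smooth vector field. -/
theorem exists_smoothField [T2Space M] (p : M) (v : TangentSpace (𝓡 d) p) :
    ∃ X : (∀ p : M, TangentSpace (𝓡 d) p), SmoothField X ∧ X p = v := by
  obtain ⟨s, hs, hsmooth⟩ := FiberBundle.exists_contMDiffOn_extend (k := ∞) (𝓡 d)
    (EuclideanSpace ℝ (Fin d)) (V := (TangentSpace (𝓡 d) : M → Type _)) v
  -- A local extension is cut off by a bump function supported inside its domain and equal to 1 at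
  -- `p`.
  obtain ⟨ψ, -, hψ⟩ := (SmoothBumpFunction.nhds_basis_tsupport (I := 𝓡 d) p).mem_iff.1
    (interior_mem_nhds.2 hs)
  refine ⟨_, ContMDiffOn.smul_section_of_tsupport (n := ∞) ψ.contMDiff.contMDiffOn isOpen_interior
    hψ (hsmooth.mono interior_subset), ?_⟩
  simp

end Fields

namespace LightlikeHypersurface

variable {n : ℕ} {N : Type*} [TopologicalSpace N]
  [ChartedSpace (EuclideanSpace ℝ (Fin (n + 2))) N] [IsManifold (𝓡 (n + 2)) ∞ N]
  {G : LorentzMetric (n + 2) N}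
  {M : Type*} [TopologicalSpace M]
  [ChartedSpace (EuclideanSpace ℝ (Fin (n + 1))) M] [IsManifold (𝓡 (n + 1)) ∞ M]
  (L : LightlikeHypersurface G M)

/-! ### Pointwise linear algebra -/

theorem eta_xi (p : M) : L.eta p (L.xi p) = 1 := (L.transversal_spec p).1

theorem eta_of_mem_screen {p : M} {v : TangentSpace (𝓡 (n + 1)) p} (hv : v ∈ L.screen p) :
    L.eta p v = 0 := (L.transversal_spec p).2.2 v hv

theorem P_mem_screen (p : M) (v : TangentSpace (𝓡 (n + 1)) p) : L.P p v ∈ L.screen p :=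
  Submodule.projection_apply_mem _ v

theorem P_add_eta_smul_xi (p : M) (v : TangentSpace (𝓡 (n + 1)) p) :
    L.P p v + L.eta p v • L.xi p = v := by
  have h : v - L.P p v ∈ radical G L.emb p :=
    Submodule.sub_projection_mem (L.screen_compl p) v
  obtain ⟨c, hc⟩ := L.mem_rad p h
  have h1 := congrArg (L.eta p) hc
  rw [map_smul, L.eta_xi, map_sub, L.eta_of_mem_screen (L.P_mem_screen p v)] at h1
  have h2 : c = L.eta p v := by simpa using h1
  rw [← h2, hc]
  abel

theorem eta_P (p : M) (v : TangentSpace (𝓡 (n + 1)) p) : L.eta p (L.P p v) = 0 :=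
  L.eta_of_mem_screen (L.P_mem_screen p v)

theorem P_eq_self_of_eta_eq_zero {p : M} {v : TangentSpace (𝓡 (n + 1)) p} (hv : L.eta p v = 0) :
    L.P p v = v := by
  simpa [hv] using L.P_add_eta_smul_xi p v

theorem g_symm (p : M) (v w : TangentSpace (𝓡 (n + 1)) p) : L.g p v w = L.g p w v :=
  G.symm _ _ _

theorem g_of_mem_rad {p : M} {w : TangentSpace (𝓡 (n + 1)) p} (hw : w ∈ L.rad p)
    (v : TangentSpace (𝓡 (n + 1)) p) : L.g p v w = 0 :=
  (L.g_symm p v w).trans (hw v)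

theorem flat_apply (p : M) (v w : TangentSpace (𝓡 (n + 1)) p) :
    L.flat p v w = L.g p v w + L.eta p v * L.eta p w := rfl

theorem flat_symm (p : M) (v w : TangentSpace (𝓡 (n + 1)) p) : L.flat p v w = L.flat p w v := by
  rw [flat_apply, flat_apply, L.g_symm, mul_comm]

/-- A nonzero null vector is never orthogonal to the timelike vector `u`, so some multiple of ξ can
be subtracted from `v` to make it orthogonal to `u`. This leaves g(v,v) unchanged and puts the
vector where the Lorentz metric is positive definite. -/
theorem g_nonneg_and_mem_rad (p : M) (v : TangentSpace (𝓡 (n + 1)) p) :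
    0 ≤ L.g p v v ∧ (L.g p v v = 0 → v ∈ L.rad p) := by
  obtain ⟨u, -, hu⟩ := G.lorentz (L.emb p)
  have hxi0 : L.dEmb p (L.xi p) ≠ 0 := fun h =>
    L.xi_ne_zero p (L.emb_immersion p (h.trans (map_zero (L.dEmb p)).symm))
  have hxixi := L.dEmb_xi p (L.xi p)
  have hvxi := L.dEmb_xi p v
  have hxiv := (G.symm (L.emb p) (L.dEmb p (L.xi p)) (L.dEmb p v)).trans hvxi
  have hne : G.val (L.emb p) u (L.dEmb p (L.xi p)) ≠ 0 := fun h =>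
    (hu _ h hxi0).ne' hxixi
  set c := G.val (L.emb p) u (L.dEmb p v) / G.val (L.emb p) u (L.dEmb p (L.xi p)) with hc
  have hort : G.val (L.emb p) u (L.dEmb p v - c • L.dEmb p (L.xi p)) = 0 := by
    rw [map_sub, map_smul, smul_eq_mul, hc, div_mul_cancel₀ _ hne, sub_self]
  have hval : G.val (L.emb p) (L.dEmb p v - c • L.dEmb p (L.xi p))
      (L.dEmb p v - c • L.dEmb p (L.xi p)) = L.g p v v := by
    simp [hxixi, hvxi, hxiv]
    rfl
  by_cases h0 : L.dEmb p v - c • L.dEmb p (L.xi p) = 0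
  · rw [h0, map_zero] at hval
    have hv : v = c • L.xi p := L.emb_immersion p <| by
      change L.dEmb p v = L.dEmb p (c • L.xi p)
      rw [map_smul]
      exact sub_eq_zero.1 h0
    exact ⟨hval.le, fun _ => hv ▸ (L.rad p).smul_mem c (L.xi_smooth.2 p)⟩
  · have h := hu _ hort h0
    rw [hval] at h
    exact ⟨h.le, fun h' => absurd h' h.ne'⟩

theorem flat_pos {p : M} {v : TangentSpace (𝓡 (n + 1)) p} (hv : v ≠ 0) : 0 < L.flat p v v := by
  obtain ⟨h1, h2⟩ := L.g_nonneg_and_mem_rad p v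
  rw [flat_apply]
  refine lt_of_le_of_ne (add_nonneg h1 (mul_self_nonneg _)) fun h => hv ?_
  have h3 := mul_self_nonneg (L.eta p v)
  have hg : L.g p v v = 0 := by linarith
  have he : L.eta p v = 0 := mul_self_eq_zero.1 (by linarith)
  obtain ⟨c, rfl⟩ := L.mem_rad p (h2 hg)
  rw [map_smul, L.eta_xi, smul_eq_mul, mul_one] at he
  rw [he, zero_smul]

theorem Q_dEmb (p : M) (v : TangentSpace (𝓡 (n + 1)) p) : L.Q p (L.dEmb p v) = v := by
  have h := Submodule.projectionOnto_apply_left (L.isCompl_tr p)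
    ⟨L.dEmb p v, LinearMap.mem_range_self _ v⟩
  simp only [Q, LinearMap.comp_apply]
  rw [h]
  exact (LinearEquiv.symm_apply_eq _).2 rfl

theorem flat_grad (f : M → ℝ) (p : M) (v : TangentSpace (𝓡 (n + 1)) p) :
    L.flat p (L.grad f p) v = mvfderiv (𝓡 (n + 1)) f p v :=
  haveI : FiniteDimensional ℝ (TangentSpace (𝓡 (n + 1)) p) :=
    inferInstanceAs (FiniteDimensional ℝ (EuclideanSpace ℝ (Fin (n + 1))))
  LinearMap.BilinForm.apply_toDual_symm_apply _ _

/-! ### The induced connection -/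

theorem differentiableAlongAt_dEmb {Y : ∀ p : M, TangentSpace (𝓡 (n + 1)) p}
    (hY : SmoothField Y) (p : M) :
    DifferentiableAlongAt (n + 1) L.emb (fun q => L.dEmb q (Y q)) p :=
  ((L.emb_smooth.contMDiff_tangentMap (m := ∞) (by simp)).comp hY).mdifferentiable (by simp) p

variable (conn : CovariantDerivative (𝓡 (n + 2)) (EuclideanSpace ℝ (Fin (n + 2)))
  (TangentSpace (𝓡 (n + 2)) : N → Type _))

variable {X X' Y Y' Z : ∀ p : M, TangentSpace (𝓡 (n + 1)) p}

theorem nabla_add_left (p : M) :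
    L.nabla conn (fun q => X q + X' q) Y p = L.nabla conn X Y p + L.nabla conn X' Y p := by
  simp only [nabla, ambient, covAlong_add_left, map_add]

theorem nabla_add_right (hY : SmoothField Y) (hY' : SmoothField Y') (p : M) :
    L.nabla conn X (fun q => Y q + Y' q) p = L.nabla conn X Y p + L.nabla conn X Y' p := by
  simp only [nabla, ambient, map_add]
  rw [covAlong_add conn (L.differentiableAlongAt_dEmb hY p) (L.differentiableAlongAt_dEmb hY' p),
    map_add]

theorem nabla_smul {h : M → ℝ} (hh : ContMDiff (𝓡 (n + 1)) 𝓘(ℝ, ℝ) ∞ h) (hY : SmoothField Y)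
    (p : M) : L.nabla conn X (fun q => h q • Y q) p =
      mvfderiv (𝓡 (n + 1)) h p (X p) • Y p + h p • L.nabla conn X Y p := by
  simp only [nabla, ambient, map_smul]
  rw [covAlong_smul conn (hh.mdifferentiable (by simp) p) (L.differentiableAlongAt_dEmb hY p),
    map_add, map_smul, map_smul, L.Q_dEmb]

/-- On a totally geodesic lightlike hypersurface the induced connection is metric. -/
theorem mvfderiv_g (hconn : IsLeviCivita G conn) (hL : L.TotallyGeodesic conn)
    (hX : SmoothField X) (hY : SmoothField Y) (hZ : SmoothField Z) (p : M) :
    mvfderiv (𝓡 (n + 1)) (fun q => L.g q (Y q) (Z q)) p (X p) =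
      L.g p (L.nabla conn X Y p) (Z p) + L.g p (Y p) (L.nabla conn X Z p) := by
  -- Total geodesy enters here: ambient derivatives of tangent fields are tangent, so ambient metric
  -- compatibility restricts to `M`.
  have h : ∀ W, SmoothField W → L.ambient conn X W p = L.dEmb p (L.nabla conn X W p) :=
    fun W hW => sub_eq_zero.1 (hL X W hX hW p)
  have h1 := mvfderiv_metric_along conn hconn (L.differentiableAlongAt_dEmb hY p)
    (L.differentiableAlongAt_dEmb hZ p) (X p)
  refine h1.trans ?_
  change G.val _ (L.ambient conn X Y p) _ + G.val _ _ (L.ambient conn X Z p) = _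
  rw [h Y hY, h Z hZ]
  rfl

end LightlikeHypersurface

namespace LightlikeHypersurface

variable {n : ℕ} {N : Type*} [TopologicalSpace N]
  [ChartedSpace (EuclideanSpace ℝ (Fin (n + 2))) N] [IsManifold (𝓡 (n + 2)) ∞ N]
  {G : LorentzMetric (n + 2) N}
  {M : Type*} [TopologicalSpace M]
  [ChartedSpace (EuclideanSpace ℝ (Fin (n + 1))) M] [IsManifold (𝓡 (n + 1)) ∞ M]
  {L : LightlikeHypersurface G M}
  {conn : CovariantDerivative (𝓡 (n + 2)) (EuclideanSpace ℝ (Fin (n + 2)))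
    (TangentSpace (𝓡 (n + 2)) : N → Type _)}
  {S : ∀ p : M, TangentSpace (𝓡 (n + 1)) p →L[ℝ] TangentSpace (𝓡 (n + 1)) p}
  {k : ℕ} {lam : Fin (k + 1) → M → ℝ}

/-! ### Eigenspaces of an `A`-tensor -/

theorem mem_eigenDist {μ : M → ℝ} {p : M} {v : TangentSpace (𝓡 (n + 1)) p} :
    v ∈ eigenDist S μ p ↔ S p v = μ p • v :=
  End.mem_eigenspace_iff

/-- S maps the screen, where η vanishes, into itself, and ξ is an eigenvector for λ_0. -/
theorem IsATensor.eta_apply (hS : L.IsATensor conn S) (hlam : L.IsEigenSystem S lam) (p : M)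
    (v : TangentSpace (𝓡 (n + 1)) p) : L.eta p (S p v) = lam 0 p * L.eta p v := by
  have hxi : S p (L.xi p) = lam 0 p • L.xi p :=
    mem_eigenDist.1 (hlam.radical_eq p ▸ L.xi_smooth.2 p)
  conv_lhs => rw [← L.P_add_eta_smul_xi p v]
  rw [map_add, map_smul, map_add, map_smul, ← hS.screen_preserving, L.eta_P, hxi, map_smul,
    L.eta_xi]
  simp [mul_comm]

theorem IsATensor.flat_symmetric (hS : L.IsATensor conn S) (hlam : L.IsEigenSystem S lam) (p : M)
    (v w : TangentSpace (𝓡 (n + 1)) p) : L.flat p (S p v) w = L.flat p v (S p w) := by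
  rw [flat_apply, flat_apply, hS.symmetric, hS.eta_apply hlam, hS.eta_apply hlam]
  ring

/-- On D_i, η ∘ S is both λ_i η and λ_0 η. Thus g~ and g agree as soon as one argument lies in such
a D_i. -/
theorem IsATensor.eta_eq_zero (hS : L.IsATensor conn S) (hlam : L.IsEigenSystem S lam)
    {i : Fin (k + 1)} (hi : i ≠ 0) {p : M} {v : TangentSpace (𝓡 (n + 1)) p}
    (hv : v ∈ eigenDist S (lam i) p) : L.eta p v = 0 := by
  have h := hS.eta_apply hlam p v
  rw [mem_eigenDist.1 hv, map_smul, smul_eq_mul] at h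
  have hne : lam i p - lam 0 p ≠ 0 := sub_ne_zero.2 fun h0 => hi (hlam.distinct p h0)
  exact (mul_eq_zero.1 (show (lam i p - lam 0 p) * L.eta p v = 0 by linarith)).resolve_left hne

theorem IsATensor.flat_orthogonal (hS : L.IsATensor conn S) (hlam : L.IsEigenSystem S lam)
    {a b : Fin (k + 1)} (hab : a ≠ b) {p : M} {v w : TangentSpace (𝓡 (n + 1)) p}
    (hv : v ∈ eigenDist S (lam a) p) (hw : w ∈ eigenDist S (lam b) p) : L.flat p v w = 0 := by
  have h := hS.flat_symmetric hlam p v w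
  rw [mem_eigenDist.1 hv, mem_eigenDist.1 hw] at h
  simp only [map_smul, LinearMap.smul_apply, smul_eq_mul] at h
  have hne : lam a p - lam b p ≠ 0 := sub_ne_zero.2 fun h0 => hab (hlam.distinct p h0)
  exact (mul_eq_zero.1 (show (lam a p - lam b p) * L.flat p v w = 0 by linarith)).resolve_left hne

/-- A vector orthogonal to all the eigenspaces of an `A`-tensor vanishes. -/
theorem IsATensor.eq_zero_of_forall_flat (hS : L.IsATensor conn S) (hlam : L.IsEigenSystem S lam)
    {p : M} {v : TangentSpace (𝓡 (n + 1)) p}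
    (hv : ∀ a, ∀ w ∈ eigenDist S (lam a) p, L.flat p v w = 0) : v = 0 := by
  have : FiniteDimensional ℝ (TangentSpace (𝓡 (n + 1)) p) :=
    inferInstanceAs (FiniteDimensional ℝ (EuclideanSpace ℝ (Fin (n + 1))))
  have htop := iSup_eigenspace_eq_top (L.flat p) (L.flat_symm p) (fun _ => L.flat_pos)
    (S p).toLinearMap (hS.flat_symmetric hlam p)
  -- The eigenspaces span, so `v` is orthogonal to everything, in particular to itself.
  have hle : ⨆ μ, End.eigenspace (S p).toLinearMap μ ≤ LinearMap.ker (L.flat p v) := by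
    refine iSup_le fun μ w hw => ?_
    rcases eq_or_ne w 0 with rfl | hw0
    · exact Submodule.zero_mem _
    · obtain ⟨a, rfl⟩ := (hlam.eigenvalues p μ).1
        (End.hasEigenvalue_of_hasEigenvector ⟨hw, hw0⟩)
      exact hv a w hw
  by_contra h0
  have hmem : v ∈ LinearMap.ker (L.flat p v) := hle (htop ▸ Submodule.mem_top)
  exact (L.flat_pos h0).ne' hmem

/-- Tested against D_a, the operator S - c acts as the scalar λ_a - c. This replaces explicit
spectral projections throughout. -/
theorem IsATensor.flat_sub_smul (hS : L.IsATensor conn S) (hlam : L.IsEigenSystem S lam)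
    {a : Fin (k + 1)} {p : M} {w : TangentSpace (𝓡 (n + 1)) p} (hw : w ∈ eigenDist S (lam a) p)
    (c : ℝ) (v : TangentSpace (𝓡 (n + 1)) p) :
    L.flat p (S p v - c • v) w = (lam a p - c) * L.flat p v w := by
  rw [map_sub, map_smul, LinearMap.sub_apply, LinearMap.smul_apply, hS.flat_symmetric hlam, mem_eigenDist.1 hw,
    map_smul]
  simp only [smul_eq_mul]
  ring

/-- A vector lies in an eigenspace as soon as it is orthogonal to the other ones. -/
theorem IsATensor.mem_eigenDist_of_flat (hS : L.IsATensor conn S) (hlam : L.IsEigenSystem S lam)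
    {i : Fin (k + 1)} {p : M} {v : TangentSpace (𝓡 (n + 1)) p}
    (hv : ∀ a, a ≠ i → ∀ w ∈ eigenDist S (lam a) p, L.flat p v w = 0) :
    v ∈ eigenDist S (lam i) p := by
  refine mem_eigenDist.2 (sub_eq_zero.1 (hS.eq_zero_of_forall_flat hlam fun a w hw => ?_))
  rw [hS.flat_sub_smul hlam hw]
  by_cases ha : a = i
  · rw [ha, sub_self, zero_mul]
  · rw [hv a ha w hw, mul_zero]

/-- The smooth field `∏ j ∈ s, (S - lam j) V`, described by its products with eigenvectors. -/
theorem IsATensor.exists_field_prod (hS : L.IsATensor conn S) (hlam : L.IsEigenSystem S lam)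
    {V : ∀ p : M, TangentSpace (𝓡 (n + 1)) p} (hV : SmoothField V) (s : Finset (Fin (k + 1))) :
    ∃ W : (∀ p : M, TangentSpace (𝓡 (n + 1)) p), SmoothField W ∧
      ∀ q a, ∀ w ∈ eigenDist S (lam a) q,
        L.flat q (W q) w = (∏ j ∈ s, (lam a q - lam j q)) * L.flat q (V q) w := by
  classical
  induction s using Finset.induction_on with
  | empty => exact ⟨V, hV, fun q a w _ => by simp⟩
  | insert j s hj ih =>
    obtain ⟨W, hW, h⟩ := ih
    refine ⟨fun q => S q (W q) - lam j q • W q,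
      (hW.endomorphism_apply hS.smooth).sub (hW.smul (hlam.smooth j)), fun q a w hw => ?_⟩
    rw [hS.flat_sub_smul hlam hw, h q a w hw, Finset.prod_insert hj]
    ring

/-- Every eigenvector extends to a smooth section of its eigendistribution. -/
theorem IsATensor.exists_section [T2Space M] (hS : L.IsATensor conn S)
    (hlam : L.IsEigenSystem S lam) (i : Fin (k + 1)) {p : M} {v : TangentSpace (𝓡 (n + 1)) p}
    (hv : v ∈ eigenDist S (lam i) p) :
    ∃ X, SmoothSectionOf (eigenDist S (lam i)) X ∧ X p = v := by
  classical
  obtain ⟨V, hV, rfl⟩ := exists_smoothField p v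
  obtain ⟨W, hW, h⟩ := hS.exists_field_prod hlam hV (Finset.univ.erase i)
  -- The product of the S - λ_j over j ≠ i maps every field into D_i and multiplies D_i at `p` by
  -- `c`. Dividing by this constant, taken at `p` only, restores the prescribed value.
  set c := ∏ j ∈ Finset.univ.erase i, (lam i p - lam j p) with hc
  have hc0 : c ≠ 0 := Finset.prod_ne_zero_iff.2 fun j hj => sub_ne_zero.2 fun h0 =>
    (Finset.ne_of_mem_erase hj) (hlam.distinct p h0).symm
  have hWmem : ∀ q, W q ∈ eigenDist S (lam i) q := fun q =>
    hS.mem_eigenDist_of_flat hlam fun a ha w hw => by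
      rw [h q a w hw, Finset.prod_eq_zero (Finset.mem_erase.2 ⟨ha, Finset.mem_univ a⟩)
        (sub_self _), zero_mul]
  have hWp : W p = c • V p := sub_eq_zero.1 <| hS.eq_zero_of_forall_flat hlam fun a w hw => by
    rw [map_sub, map_smul, LinearMap.sub_apply, LinearMap.smul_apply, smul_eq_mul]
    by_cases ha : a = i
    · subst ha
      rw [h p a w hw, sub_self]
    · rw [hS.flat_orthogonal hlam (Ne.symm ha) (hWmem p) hw,
        hS.flat_orthogonal hlam (Ne.symm ha) hv hw, mul_zero, sub_zero]
  refine ⟨fun q => c⁻¹ • W q, ⟨hW.smul (h := fun _ => c⁻¹) contMDiff_const,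
    fun q => Submodule.smul_mem _ _ (hWmem q)⟩, ?_⟩
  simp only [hWp, smul_smul, inv_mul_cancel₀ hc0, one_smul]

/-! ### The covariant derivative of an `A`-tensor -/

variable {X X' Y Y' : ∀ p : M, TangentSpace (𝓡 (n + 1)) p}

theorem nablaS_add_left (p : M) :
    L.nablaS conn S (fun q => X q + X' q) Y p = L.nablaS conn S X Y p + L.nablaS conn S X' Y p := by
  simp only [nablaS, nabla_add_left, map_add]
  abel

theorem IsATensor.nablaS_add_right (hS : L.IsATensor conn S) (hY : SmoothField Y)
    (hY' : SmoothField Y') (p : M) :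
    L.nablaS conn S X (fun q => Y q + Y' q) p = L.nablaS conn S X Y p + L.nablaS conn S X Y' p := by
  simp only [nablaS, map_add]
  rw [L.nabla_add_right conn hY hY', L.nabla_add_right conn (hY.endomorphism_apply hS.smooth)
    (hY'.endomorphism_apply hS.smooth), map_add]
  abel

/-- The polarized form of the cyclic condition, with two equal arguments. -/
theorem IsATensor.cyclic_polarized (hS : L.IsATensor conn S) (hX : SmoothField X)
    (hY : SmoothField Y) (p : M) :
    L.flat p (Y p) (L.nablaS conn S X X p) + L.flat p (X p) (L.nablaS conn S X Y p) +
      L.flat p (X p) (L.nablaS conn S Y X p) = 0 := by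
  have expand : ∀ Z : (∀ p : M, TangentSpace (𝓡 (n + 1)) p), SmoothField Z →
      (L.flat p (Z p) (L.nablaS conn S X X p) + L.flat p (X p) (L.nablaS conn S X Z p) +
      L.flat p (X p) (L.nablaS conn S Z X p)) +
      (L.flat p (X p) (L.nablaS conn S Z Z p) + L.flat p (Z p) (L.nablaS conn S X Z p) +
      L.flat p (Z p) (L.nablaS conn S Z X p)) = 0 := fun Z hZ => by
    have h := hS.cyclic _ (hX.add hZ) p
    have hXX := hS.cyclic _ hX p
    have hZZ := hS.cyclic _ hZ p
    simp only [nablaS_add_left, hS.nablaS_add_right hX hZ, map_add, LinearMap.add_apply] at h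
    linarith
  -- In `expand` the first group is linear in Z and the second quadratic. Comparing Z = Y with Z =
  -- 2Y isolates the linear one.
  have h1 := expand Y hY
  have h2 := expand _ (hY.add hY)
  simp only [nablaS_add_left, hS.nablaS_add_right hY hY, map_add, LinearMap.add_apply] at h2
  linarith

theorem nablaS_of_section (hlam : L.IsEigenSystem S lam) {a : Fin (k + 1)}
    (hY : SmoothSectionOf (eigenDist S (lam a)) Y) (p : M) :
    L.nablaS conn S X Y p = mvfderiv (𝓡 (n + 1)) (lam a) p (X p) • Y p -
      (S p (L.nabla conn X Y p) - lam a p • L.nabla conn X Y p) := by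
  have h : (fun q => S q (Y q)) = fun q => lam a q • Y q :=
    funext fun q => mem_eigenDist.1 (hY.2 q)
  rw [nablaS, h, L.nabla_smul conn (hlam.smooth a) hY.1]
  abel

theorem IsATensor.flat_nablaS (hS : L.IsATensor conn S) (hlam : L.IsEigenSystem S lam)
    {a b : Fin (k + 1)} (hY : SmoothSectionOf (eigenDist S (lam a)) Y) {p : M}
    {w : TangentSpace (𝓡 (n + 1)) p} (hw : w ∈ eigenDist S (lam b) p) :
    L.flat p w (L.nablaS conn S X Y p) = mvfderiv (𝓡 (n + 1)) (lam a) p (X p) * L.flat p w (Y p) +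
      (lam a p - lam b p) * L.flat p w (L.nabla conn X Y p) := by
  rw [nablaS_of_section hlam hY, map_sub, map_smul, L.flat_symm p w (_ - _),
    hS.flat_sub_smul hlam hw, L.flat_symm p _ w]
  simp only [smul_eq_mul]
  ring

/-! ### Components of ∇_X X along the eigendistributions. -/

variable {i : Fin (k + 1)}

/-- An eigenfunction is constant along its own eigendistribution. -/
theorem IsATensor.mvfderiv_eigenfunction_self (hS : L.IsATensor conn S)
    (hlam : L.IsEigenSystem S lam) (hX : SmoothSectionOf (eigenDist S (lam i)) X) (p : M) :
    mvfderiv (𝓡 (n + 1)) (lam i) p (X p) = 0 := by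
  by_cases h0 : X p = 0
  · rw [h0, map_zero]
  · have h := hS.cyclic X hX.1 p
    -- The factor λ_i - λ_i removes ∇_X X, leaving dλ_i(X) g~(X,X) = 0.
    rw [hS.flat_nablaS hlam hX (hX.2 p), sub_self, zero_mul, add_zero] at h
    exact (mul_eq_zero.1 h).resolve_right (L.flat_pos h0).ne'

theorem IsATensor.nablaS_self_eq_zero_iff (hS : L.IsATensor conn S)
    (hlam : L.IsEigenSystem S lam) (hX : SmoothSectionOf (eigenDist S (lam i)) X) (p : M) :
    L.nablaS conn S X X p = 0 ↔ L.nabla conn X X p ∈ eigenDist S (lam i) p := by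
  rw [nablaS_of_section hlam hX, hS.mvfderiv_eigenfunction_self hlam hX, zero_smul, zero_sub,
    neg_eq_zero, sub_eq_zero, mem_eigenDist]

theorem IsATensor.g_orthogonal (hS : L.IsATensor conn S) (hlam : L.IsEigenSystem S lam)
    {b : Fin (k + 1)} (hi : i ≠ 0) (hb : b ≠ i) {p : M} {v w : TangentSpace (𝓡 (n + 1)) p}
    (hv : v ∈ eigenDist S (lam i) p) (hw : w ∈ eigenDist S (lam b) p) : L.g p v w = 0 := by
  have h := hS.flat_orthogonal hlam hb.symm hv hw
  rwa [flat_apply, hS.eta_eq_zero hlam hi hv, zero_mul, add_zero] at h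

/-- The relation between the derivative of an eigenfunction and the components of `∇_X X`. -/
theorem IsATensor.mvfderiv_eigenfunction (hconn : IsLeviCivita G conn)
    (hL : L.TotallyGeodesic conn) (hS : L.IsATensor conn S) (hlam : L.IsEigenSystem S lam)
    (hi : i ≠ 0) {b : Fin (k + 1)} (hb : b ≠ i) (hX : SmoothSectionOf (eigenDist S (lam i)) X)
    (hY : SmoothSectionOf (eigenDist S (lam b)) Y) (p : M) :
    mvfderiv (𝓡 (n + 1)) (lam i) p (Y p) * L.flat p (X p) (X p) =
      (lam b p - lam i p) * (L.flat p (Y p) (L.nabla conn X X p) +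
        L.g p (L.nabla conn X X p) (Y p)) := by
  have h := hS.cyclic_polarized hX.1 hY.1 p
  rw [hS.flat_nablaS hlam hX (hY.2 p), hS.flat_nablaS hlam hX (hX.2 p),
    hS.flat_nablaS hlam hY (hX.2 p), hS.flat_orthogonal hlam hb (hY.2 p) (hX.2 p),
    hS.flat_orthogonal hlam hb.symm (hX.2 p) (hY.2 p), L.flat_apply p (X p) (L.nabla conn X Y p),
    hS.eta_eq_zero hlam hi (hX.2 p)] at h
  -- Differentiating g(X,Y) = 0 along X trades g(X, ∇_X Y) for -g(∇_X X, Y).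
  have hzero : (fun q => L.g q (X q) (Y q)) = fun _ => 0 :=
    funext fun q => hS.g_orthogonal hlam hi hb (hX.2 q) (hY.2 q)
  have hm := L.mvfderiv_g conn hconn hL hX.1 hX.1 hY.1 p
  rw [hzero, mvfderiv_const, zero_apply] at hm
  linear_combination h + (lam b p - lam i p) * hm

/-- X is screen-valued, so PX = X, and η does not see the screen part of ∇_X X. -/
theorem IsATensor.C_self (hS : L.IsATensor conn S) (hlam : L.IsEigenSystem S lam) (hi : i ≠ 0)
    (hX : SmoothSectionOf (eigenDist S (lam i)) X) (p : M) :
    L.C conn X X p = L.eta p (L.nabla conn X X p) := by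
  have h : (fun q => L.P q (X q)) = X :=
    funext fun q => L.P_eq_self_of_eta_eq_zero (hS.eta_eq_zero hlam hi (hX.2 q))
  rw [C, screenForm, h, map_sub, L.eta_P, sub_zero]

theorem smoothSectionOf_add (hX : SmoothSectionOf (eigenDist S (lam i)) X)
    (hY : SmoothSectionOf (eigenDist S (lam i)) Y) :
    SmoothSectionOf (eigenDist S (lam i)) fun q => X q + Y q :=
  ⟨hX.1.add hY.1, fun q => Submodule.add_mem _ (hX.2 q) (hY.2 q)⟩

theorem IsATensor.grad_mem_and_C_eq_zero [T2Space M] (hconn : IsLeviCivita G conn)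
    (hL : L.TotallyGeodesic conn) (hS : L.IsATensor conn S) (hlam : L.IsEigenSystem S lam)
    (hi : i ≠ 0) (h : ∀ X, SmoothSectionOf (eigenDist S (lam i)) X →
      ∀ p, L.nabla conn X X p ∈ eigenDist S (lam i) p) :
    (∀ p, L.grad (lam i) p ∈ eigenDist S (lam 0) p) ∧
      ∀ X, SmoothSectionOf (eigenDist S (lam i)) X → ∀ p, L.C conn X X p = 0 := by
  refine ⟨fun p => hS.mem_eigenDist_of_flat hlam fun b hb w hw => ?_, fun X hX p => ?_⟩
  · rw [L.flat_grad]
    obtain ⟨Y, hY, rfl⟩ := hS.exists_section hlam b hw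
    by_cases hbi : b = i
    · subst hbi
      exact hS.mvfderiv_eigenfunction_self hlam hY p
    -- A section X nonzero at `p` is needed to cancel g~(X,X); it exists because λ_i(p) is an
    -- eigenvalue.
    · obtain ⟨v, hv, hv0⟩ := ((hlam.eigenvalues p (lam i p)).2 ⟨i, rfl⟩).exists_hasEigenvector
      obtain ⟨X, hX, rfl⟩ := hS.exists_section hlam i hv
      have h1 := hS.mvfderiv_eigenfunction hconn hL hlam hi hbi hX hY p
      rw [hS.flat_orthogonal hlam hbi hw (h X hX p),
        hS.g_orthogonal hlam hi hbi (h X hX p) hw, add_zero, mul_zero] at h1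
      exact (mul_eq_zero.1 h1).resolve_right (L.flat_pos hv0).ne'
  · rw [hS.C_self hlam hi hX]
    exact hS.eta_eq_zero hlam hi (h X hX p)

theorem IsATensor.nabla_self_mem [T2Space M] (hconn : IsLeviCivita G conn)
    (hL : L.TotallyGeodesic conn) (hS : L.IsATensor conn S) (hlam : L.IsEigenSystem S lam)
    (hi : i ≠ 0) (hX : SmoothSectionOf (eigenDist S (lam i)) X) {p : M}
    (hgrad : L.grad (lam i) p ∈ eigenDist S (lam 0) p) (hC : L.C conn X X p = 0) :
    L.nabla conn X X p ∈ eigenDist S (lam i) p := by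
  refine hS.mem_eigenDist_of_flat hlam fun b hb w hw => ?_
  by_cases hb0 : b = 0
  · subst hb0
    rw [hlam.radical_eq] at hw
    rw [flat_apply, L.g_of_mem_rad hw, ← hS.C_self hlam hi hX, hC, zero_mul, add_zero]
  · obtain ⟨Y, hY, rfl⟩ := hS.exists_section hlam b hw
    have h1 := hS.mvfderiv_eigenfunction hconn hL hlam hi hb hX hY p
    -- The gradient is orthogonal to Y, and η(Y) = 0 makes both summands equal to g(∇_X X, Y), which
    -- therefore vanishes.
    rw [← L.flat_grad, hS.flat_orthogonal hlam (Ne.symm hb0) hgrad hw, zero_mul, L.flat_symm,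
      flat_apply, hS.eta_eq_zero hlam hb0 hw, mul_zero, add_zero] at h1
    have hne : lam b p - lam i p ≠ 0 := sub_ne_zero.2 fun h0 => hb (hlam.distinct p h0)
    rw [flat_apply, hS.eta_eq_zero hlam hb0 hw, mul_zero, add_zero]
    have h2 := (mul_eq_zero.1 h1.symm).resolve_left hne
    linarith

end LightlikeHypersurface
end NullGeometry

/-! ### Equivalence of the five conditions. -/

theorem corollary5p3 {n : ℕ}
    {N : Type*} [TopologicalSpace N] [T2Space N]
    [ChartedSpace (EuclideanSpace ℝ (Fin (n + 2))) N] [IsManifold (𝓡 (n + 2)) ∞ N]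
    (G : LorentzMetric (n + 2) N)
    (conn : CovariantDerivative (𝓡 (n + 2)) (EuclideanSpace ℝ (Fin (n + 2)))
      (TangentSpace (𝓡 (n + 2)) : N → Type _))
    (hconn : IsLeviCivita G conn)
    {M : Type*} [TopologicalSpace M] [T2Space M]
    [ChartedSpace (EuclideanSpace ℝ (Fin (n + 1))) M] [IsManifold (𝓡 (n + 1)) ∞ M]
    (L : LightlikeHypersurface G M)
    (hL : L.TotallyGeodesic conn)
    (S : ∀ p : M, TangentSpace (𝓡 (n + 1)) p →L[ℝ] TangentSpace (𝓡 (n + 1)) p)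
    (hS : L.IsATensor conn S)
    {k : ℕ} (lam : Fin (k + 1) → M → ℝ) (hlam : L.IsEigenSystem S lam)
    (i : Fin (k + 1)) (hi : i ≠ 0) :
    [ ∀ X, SmoothSectionOf (eigenDist S (lam i)) X →
        ∀ p, L.nabla conn X X p ∈ eigenDist S (lam i) p,
      ∀ X Y, SmoothSectionOf (eigenDist S (lam i)) X → SmoothSectionOf (eigenDist S (lam i)) Y →
        ∀ p, L.nabla conn X Y p + L.nabla conn Y X p ∈ eigenDist S (lam i) p,
      ∀ X, SmoothSectionOf (eigenDist S (lam i)) X →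
        ∀ p, L.nablaS conn S X X p = 0,
      ∀ X Y, SmoothSectionOf (eigenDist S (lam i)) X → SmoothSectionOf (eigenDist S (lam i)) Y →
        ∀ p, L.nablaS conn S X Y p + L.nablaS conn S Y X p = 0,
      (∀ p, L.grad (lam i) p ∈ eigenDist S (lam 0) p) ∧
        ∀ X, SmoothSectionOf (eigenDist S (lam i)) X → ∀ p, L.C conn X X p = 0 ].TFAE := by
  tfae_have 2 → 1 := fun h X hX p => by
    have h2 := Submodule.smul_mem _ (2⁻¹ : ℝ) (h X X hX hX p)
    rwa [← two_smul ℝ, smul_smul, inv_mul_cancel₀ (two_ne_zero' ℝ), one_smul] at h2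
  tfae_have 1 → 2 := fun h X Y hX hY p => by
    have h2 := h _ (LightlikeHypersurface.smoothSectionOf_add hX hY) p
    rw [L.nabla_add_left, L.nabla_add_right conn hX.1 hY.1, L.nabla_add_right conn hX.1 hY.1] at h2
    have h3 := Submodule.sub_mem _ (Submodule.sub_mem _ h2 (h X hX p)) (h Y hY p)
    convert h3 using 1
    abel
  tfae_have 1 ↔ 3 := forall₂_congr fun X hX => forall_congr' fun p =>
    (hS.nablaS_self_eq_zero_iff hlam hX p).symm
  tfae_have 4 → 3 := fun h X hX p => by
    have h2 := h X X hX hX p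
    rw [← two_smul ℝ] at h2
    exact (smul_eq_zero.1 h2).resolve_left two_ne_zero
  tfae_have 3 → 4 := fun h X Y hX hY p => by
    have h2 := h _ (LightlikeHypersurface.smoothSectionOf_add hX hY) p
    rw [LightlikeHypersurface.nablaS_add_left, hS.nablaS_add_right hX.1 hY.1,
      hS.nablaS_add_right hX.1 hY.1, h X hX p, h Y hY p, zero_add, add_zero] at h2
    exact h2
  tfae_have 1 → 5 := fun h => hS.grad_mem_and_C_eq_zero hconn hL hlam hi h
  tfae_have 5 → 1 := fun h X hX p => hS.nabla_self_mem hconn hL hlam hi hX (h.1 p) (h.2 X hX p)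
  tfae_finish
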